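/- All spaces are compact Hausdorff. A \emph{cover} of $X$ is a pair $(Y,f)$ with $f:Y\to X$ a perfect irreducible continuous surjection (irreducible: $f(F)\neq X$ for every proper closed $F\subsetneq Y$). For covers of a fixed $X$, $(Y_1,f_1)\le (Y_2,f_2)$ means $f_2=f_1\circ f$ for some continuous $f:Y_2\to Y_1$. A \emph{covering operator} $c$ assigns to each $X$ a cover $(cX,c_X)$ of $X$ that is the minimum among all covers $(Y,f)$ of $X$ with $c_Y$ a homeomorphism; the spaces $X$ with $c_X$ a homeomorphism are said to be fixed by $c$, written $cX=X$. A space is \emph{quasi-$F$} if each of its dense cozero-sets $U$ is $C^*$-embedded (every bounded continuous $U\to\mathbb R$ extends continuously to the space), and \emph{almost-$P$} if it has no proper dense cozero-set. Let $qF$ be the covering operator whose fixed spaces are exactly the compact Hausdorff quasi-$F$ spaces; thus $(qF\,X,qF_X)$ is the minimum quasi-$F$ cover of $X$. For a space $K$ with $cK=K$ let $\mathcal S(K,c)$ be the collection of all $X$ with $cX=K$, i.e. of all pairs $(X,f)$ with $f:K\to X$ equal to $c_X$ up to a homeomorphism $K\cong cX$. It is ordered by $(X_1,f_1)\le (X_2,f_2)$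 iff $f_1=f\circ f_2$ for some continuous $f:X_2\to X_1$, and pairs that are $\le$ each other are identified. Let $\beta\mathbb N$ and $\alpha\mathbb N$ be the Čech–Stone and the one-point compactification of the discrete space $\mathbb N$. \begin{itemize} \item[(i)] $qF\,\beta\mathbb N=\beta\mathbb N$, and $\mathcal S(\beta\mathbb N,qF)$ has minimum $\alpha\mathbb N$ (with the canonical map $\beta\mathbb N\to\alpha\mathbb N$). \item[(ii)] If $K$ is compact Hausdorff and almost-$P$, then $qF\,K=K$ and $\mathcal S(K,qF)=\{K\}$ (with the identity map of $K$), which has minimum $K$. \end{itemize} -/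

import Mathlib

open Topology BoundedContinuousFunction

namespace CoveringOps

universe u v w

/-- A covering map: a perfect irreducible continuous surjection. -/
structure IsCoverMap {Y : Type u} {X : Type v} [TopologicalSpace Y] [TopologicalSpace X]
    (f : Y → X) : Prop where
  continuous : Continuous f
  isClosedMap : IsClosedMap f
  isCompact_fiber : ∀ x : X, IsCompact (f ⁻¹' {x})
  surjective : Function.Surjective f
  /-- no proper closed set is mapped onto the target -/
  irreducible : ∀ F : Set Y, IsClosed F → F ≠ Set.univ → f '' F ≠ Set.univ

/-- A cozero-set of a space: the set where some continuous real function does not vanish. -/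
def IsCozeroSet {X : Type u} [TopologicalSpace X] (U : Set X) : Prop :=
  ∃ f : C(X, ℝ), U = {x | f x ≠ 0}

/-- `U` is `C*`-embedded in `X`: every bounded continuous real function on `U` extends
continuously over `X`. -/
def IsCStarEmbedded {X : Type u} [TopologicalSpace X] (U : Set X) : Prop :=
  ∀ h : U →ᵇ ℝ, ∃ H : C(X, ℝ), ∀ x : U, H x = h x

/-- Quasi-F spaces (for compact Hausdorff, hence Tychonoff, spaces below). -/
def IsQuasiF (X : Type u) [TopologicalSpace X] : Prop :=
  ∀ U : Set X, IsCozeroSet U → Dense U → IsCStarEmbedded U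

/-- Almost-P spaces: there is no proper dense cozero-set. -/
def IsAlmostP (X : Type u) [TopologicalSpace X] : Prop :=
  ∀ U : Set X, IsCozeroSet U → Dense U → U = Set.univ

/-- A cover `(Y, f)` of the compact Hausdorff space `X`, within compact Hausdorff spaces. -/
structure Cover (X : CompHaus.{u}) where
  space : CompHaus.{u}
  map : C(space, X)
  isCoverMap : IsCoverMap map

/-- The preorder on covers of `X`: `(X₁, f₁) ≤ (X₂, f₂)` iff `f₂` factors as `f₁ ∘ f`. -/
instance (X : CompHaus.{u}) : Preorder (Cover X) where
  le Z₁ Z₂ := ∃ f : C(Z₂.space, Z₁.space), Z₂.map = Z₁.map.comp f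
  le_refl Z := ⟨ContinuousMap.id _, rfl⟩
  le_trans Z₁ Z₂ Z₃ := by
    rintro ⟨f, hf⟩ ⟨g, hg⟩
    exact ⟨f.comp g, by rw [hg, hf]; rfl⟩

/-- A space `X` covered by the compact Hausdorff space `K`, with the covering map `X ← K`. -/
structure CoveredBy (K : CompHaus.{u}) where
  space : CompHaus.{u}
  map : C(K, space)
  isCoverMap : IsCoverMap map

/-- The preorder on the spaces covered by `K`: `(X₁, f₁) ≤ (X₂, f₂)` iff `f₁` factors as
`f ∘ f₂`. -/
instance (K : CompHaus.{u}) : Preorder (CoveredBy K) where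
  le Z₁ Z₂ := ∃ f : C(Z₂.space, Z₁.space), Z₁.map = f.comp Z₂.map
  le_refl Z := ⟨ContinuousMap.id _, rfl⟩
  le_trans Z₁ Z₂ Z₃ := by
    rintro ⟨f, hf⟩ ⟨g, hg⟩
    exact ⟨f.comp g, by rw [hf, hg]; rfl⟩

/-- The partially ordered collection of equivalence classes of spaces covered by `K`. -/
abbrev CoveredClass (K : CompHaus.{u}) : Type (u + 1) :=
  Antisymmetrization (CoveredBy K) (· ≤ ·)

/-- The equivalence class of a space covered by `K`. -/
def CoveredBy.toClass {K : CompHaus.{u}} (x : CoveredBy K) : CoveredClass K :=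
  toAntisymmetrization (· ≤ ·) x

/-- A covering operator on compact Hausdorff spaces: it assigns to each `X` a cover `(cX, c_X)`
that is the minimum among all covers `(Y, f)` of `X` for which `c_Y` is a homeomorphism. -/
structure CoveringOperator where
  cover : ∀ X : CompHaus.{u}, Cover X
  isLeast : ∀ X : CompHaus.{u},
    IsLeast {Z : Cover X | IsHomeomorph (cover Z.space).map} (cover X)

/-- The class of spaces fixed by a covering operator. -/
def CoveringOperator.Fix (c : CoveringOperator.{u}) : Set CompHaus.{u} :=
  {X | IsHomeomorph (c.cover X).map}

/-- `S(K, c)`, the collection of all `X` with `cX = K`: the classes of all pairs `(X, f)`,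
`f : K → X`, such that `f` is `c_X` up to a homeomorphism of `K` onto `cX`. -/
def S (K : CompHaus.{u}) (c : CoveringOperator.{u}) : Set (CoveredClass K) :=
  {q | ∃ x : CoveredBy K,
    (∃ θ : K ≃ₜ (c.cover x.space).space, ∀ k, (c.cover x.space).map (θ k) = x.map k) ∧
      x.toClass = q}

section existence

variable {X : Type u} {Y : Type v} {Z : Type w}
  [TopologicalSpace X] [TopologicalSpace Y] [TopologicalSpace Z]

theorem isCoverMap_of_compact [CompactSpace Y] [T2Space X] {f : Y → X} (hf : Continuous f)
    (hs : Function.Surjective f)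
    (hi : ∀ F : Set Y, IsClosed F → f '' F = Set.univ → F = Set.univ) : IsCoverMap f where
  continuous := hf
  isClosedMap := hf.isClosedMap
  isCompact_fiber _ := (isClosed_singleton.preimage hf).isCompact
  surjective := hs
  irreducible F hF hne h := hne (hi F hF h)

theorem IsCoverMap.eq_univ {f : Y → X} (hf : IsCoverMap f) {F : Set Y} (hF : IsClosed F)
    (h : f '' F = Set.univ) : F = Set.univ := by
  by_contra hne
  exact hf.irreducible F hF hne h

theorem isCoverMap_of_isHomeomorph [CompactSpace Y] [T2Space X] {f : Y → X}
    (hf : IsHomeomorph f) : IsCoverMap f := by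
  refine isCoverMap_of_compact hf.continuous hf.surjective fun F _ h => ?_
  rw [← Set.preimage_image_eq F hf.injective, h, Set.preimage_univ]

/-- The left factor of a cover is a cover. -/
theorem IsCoverMap.left [CompactSpace Y] [T2Space X] {e : Z → Y} {m : Y → X}
    (h : IsCoverMap (m ∘ e)) (he : Continuous e) (hes : Function.Surjective e)
    (hm : Continuous m) : IsCoverMap m := by
  refine isCoverMap_of_compact hm h.surjective.of_comp fun F hF hF' => ?_
  have : e ⁻¹' F = Set.univ := by
    refine h.eq_univ (hF.preimage he) ?_
    rw [Set.image_comp, Set.image_preimage_eq F hes, hF']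
  rw [← Set.image_preimage_eq F hes, this, Set.image_univ, hes.range_eq]

/-- The right factor of a cover is a cover. -/
theorem IsCoverMap.right [CompactSpace Z] [T2Space Y] {e : Z → Y} {m : Y → X}
    (h : IsCoverMap (m ∘ e)) (he : Continuous e) (hm : IsCoverMap m) : IsCoverMap e := by
  refine isCoverMap_of_compact he ?_ fun F hF hF' => ?_
  · rw [← Set.range_eq_univ]
    refine hm.eq_univ (isCompact_range he).isClosed ?_
    rw [← Set.range_comp, h.surjective.range_eq]
  · refine h.eq_univ hF ?_
    rw [Set.image_comp, hF', Set.image_univ, hm.surjective.range_eq]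

/-- Preimages of dense open sets under covers are dense. -/
theorem IsCoverMap.dense_preimage {f : Y → X} (hf : IsCoverMap f) {U : Set X}
    (hU : Dense U) : Dense (f ⁻¹' U) := by
  rw [dense_iff_closure_eq]
  refine hf.eq_univ isClosed_closure ?_
  have h1 : U ⊆ f '' closure (f ⁻¹' U) := by
    intro x hx
    obtain ⟨y, rfl⟩ := hf.surjective x
    exact ⟨y, subset_closure hx, rfl⟩
  exact Set.eq_univ_of_univ_subset
    (hU.closure_eq ▸ closure_minimal h1 (hf.isClosedMap _ isClosed_closure))

theorem IsCozeroSet.preimage {f : Y → X} (hf : Continuous f) {U : Set X}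
    (hU : IsCozeroSet U) : IsCozeroSet (f ⁻¹' U) := by
  obtain ⟨a, rfl⟩ := hU
  exact ⟨a.comp ⟨f, hf⟩, rfl⟩

theorem IsCozeroSet.isOpen {U : Set X} (hU : IsCozeroSet U) : IsOpen U := by
  obtain ⟨a, rfl⟩ := hU
  exact isOpen_ne_fun a.continuous continuous_const

/-- A bounded continuous function on `U` pulls back to the preimage of `U`. -/
noncomputable def pull {f : Y → X} (hf : Continuous f) {U : Set X} (h : U →ᵇ ℝ) :
    (f ⁻¹' U : Set Y) →ᵇ ℝ :=
  h.compContinuous ⟨fun y => ⟨f y.1, y.2⟩, by fun_prop⟩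

/-- The quasi-F property is a topological invariant. -/
theorem IsQuasiF.of_homeomorph (h : X ≃ₜ Y) (hX : IsQuasiF X) : IsQuasiF Y := by
  intro U hU hd k
  obtain ⟨H, hH⟩ := hX _ (hU.preimage h.continuous) (hd.preimage h.isOpenMap)
    (pull h.continuous k)
  refine ⟨H.comp ⟨h.symm, h.symm.continuous⟩, fun x => ?_⟩
  have := hH ⟨h.symm x.1, by simp⟩
  simpa [pull] using this

/-- Factorization through a surjection of a compact space onto a Hausdorff one. -/
theorem exists_factor [CompactSpace Z] [T2Space Y] (e : C(Z, Y))
    (he : Function.Surjective e) (g : C(Z, X)) (h : ∀ a b, e a = e b → g a = g b) :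
    ∃ m : C(Y, X), ∀ z, m (e z) = g z := by
  have hq : IsQuotientMap e := e.continuous.isClosedMap.isQuotientMap e.continuous he
  refine ⟨hq.lift g fun a b hab => h a b hab, fun z => ?_⟩
  exact congrArg (fun k : C(Z, X) => k z) (hq.lift_comp g fun a b hab => h a b hab)

end existence

/-- Projective compact Hausdorff spaces are quasi-F. -/
theorem isQuasiF_of_projective (E : Type u) [TopologicalSpace E] [CompactSpace E] [T2Space E]
    (hE : CompactT2.Projective E) : IsQuasiF E := by
  intro U _ hd h
  let Γ : Set (E × ℝ) := Set.range fun x : U => (x.1, h x)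
  have hcpt : IsCompact (closure Γ) := by
    refine (isCompact_univ.prod (isCompact_closedBall (0 : ℝ) ‖h‖)).of_isClosed_subset
      isClosed_closure (closure_minimal ?_ (isClosed_univ.prod Metric.isClosed_closedBall))
    rintro _ ⟨x, rfl⟩
    exact ⟨trivial, by simpa using h.norm_coe_le_norm x⟩
  have : CompactSpace (closure Γ) := isCompact_iff_compactSpace.mp hcpt
  have hsurj : Function.Surjective fun p : closure Γ => p.1.1 := by
    have hcl : IsClosed (Prod.fst '' closure Γ) := (hcpt.image continuous_fst).isClosed
    have hsub : U ⊆ Prod.fst '' closure Γ := fun x hx =>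
      ⟨(x, h ⟨x, hx⟩), subset_closure ⟨⟨x, hx⟩, rfl⟩, rfl⟩
    intro x
    have hx : x ∈ Prod.fst '' closure Γ :=
      closure_minimal hsub hcl (hd.closure_eq ▸ Set.mem_univ x)
    obtain ⟨p, hp, rfl⟩ := hx
    exact ⟨⟨p, hp⟩, rfl⟩
  obtain ⟨s, hs, hs'⟩ := hE (Y := closure Γ) (Z := E) (f := id)
    (g := fun p => p.1.1) continuous_id (by fun_prop) hsurj
  have hgraph : ∀ x : U, ∀ t : ℝ, (x.1, t) ∈ closure Γ → t = h x := by
    intro x t hxt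
    have hmaps : ∀ p : U × ℝ, (p.1.1, p.2) ∈ Γ → p.2 = h p.1 := by
      rintro ⟨y, r⟩ ⟨z, hz⟩
      obtain ⟨h1, h2⟩ := Prod.ext_iff.1 hz
      obtain rfl : z = y := Subtype.ext h1
      exact h2.symm
    have hcl : IsClosed {p : U × ℝ | p.2 = h p.1} :=
      isClosed_eq continuous_snd (h.continuous.comp continuous_fst)
    let i : U × ℝ → E × ℝ := Prod.map Subtype.val id
    have hi : IsInducing i := IsInducing.subtypeVal.prodMap IsInducing.id
    have him : Γ = i '' {p : U × ℝ | p.2 = h p.1} := by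
      ext ⟨a, b⟩
      constructor
      · rintro ⟨z, hz⟩
        exact ⟨(z, h z), rfl, hz⟩
      · rintro ⟨⟨z, r⟩, hr, hz⟩
        refine ⟨z, ?_⟩
        rw [← hz]
        exact Prod.ext rfl (Eq.symm hr)
    have hmem : (x, t) ∈ closure {p : U × ℝ | p.2 = h p.1} := by
      rw [hi.closure_eq_preimage_closure_image, ← him]
      exact hxt
    rwa [hcl.closure_eq] at hmem
  refine ⟨⟨fun x => (s x).1.2, by fun_prop⟩, fun x => hgraph x _ ?_⟩
  have h1 : (s x.1).1.1 = x.1 := congrFun hs' x.1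
  have h2 := (s x.1).2
  have h3 : (s x.1).1 = (x.1, (s x.1).1.2) := Prod.ext h1 rfl
  rw [h3] at h2
  exact h2

/-- A compact Hausdorff space that receives a map from a discrete space has a projective cover. -/
theorem exists_projective_cover_aux (X : CompHaus.{u}) (D : Type u) [TopologicalSpace D]
    [DiscreteTopology D] (d : D → X) (hd : Function.Surjective d) :
    ∃ G : Cover X, CompactT2.Projective G.space := by
  have hdc : Continuous d := continuous_of_discreteTopology
  have hp : Continuous (stoneCechExtend hdc) := continuous_stoneCechExtend hdc
  have hps : Function.Surjective (stoneCechExtend hdc) := fun x => by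
    obtain ⟨y, rfl⟩ := hd x
    exact ⟨stoneCechUnit y, stoneCechExtend_stoneCechUnit hdc y⟩
  have hT2 : T2Space X := X.is_hausdorff
  have hT1 : T1Space X := T2Space.t1Space
  obtain ⟨E, hE, hES, hEi⟩ := exists_compact_surjective_zorn_subset hp hps
  have hEcl : IsClosed E := (isCompact_iff_compactSpace.mpr hE).isClosed
  let π : E → X := E.domRestrict (stoneCechExtend hdc)
  have hπ : Continuous π := hp.comp continuous_subtype_val
  have hπs : Function.Surjective π := by
    rw [← Set.range_eq_univ, Set.range_domRestrict, hES]
  have hcov : IsCoverMap π := isCoverMap_of_compact hπ hπs fun F hF h => by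
    by_contra hne
    exact hEi F hne hF h
  obtain ⟨r, hr, hr'⟩ := StoneCech.projective (X := D) hp hπ hπs
  have hπr : ∀ x, π (r x) = stoneCechExtend hdc x := fun x => congrFun hr' x
  have hid : ∀ x : E, r x = x := by
    intro x
    by_contra hne
    obtain ⟨V, U, hV, hU, hxV, hxU, hVU⟩ := t2_separation hne
    have hre : Continuous fun y : E => r y := hr.comp continuous_subtype_val
    let W : Set E := U ∩ (fun y : E => r y) ⁻¹' V
    have hW : IsOpen W := hU.inter (hV.preimage hre)
    have hun : Wᶜ = Set.univ := by
      refine hcov.eq_univ hW.isClosed_compl (Set.eq_univ_of_forall fun z => ?_)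
      obtain ⟨y, rfl⟩ := hπs z
      by_cases hy : y ∈ W
      · exact ⟨r y, fun hw => Set.disjoint_left.1 hVU hy.2 hw.1, hπr y⟩
      · exact ⟨y, hy, rfl⟩
    have : x ∈ Wᶜ := hun ▸ Set.mem_univ x
    exact this ⟨hxU, hxV⟩
  refine ⟨⟨CompHaus.of E, ⟨π, hπ⟩, hcov⟩, ?_⟩
  intro A B _ _ _ _ _ _ f g hf hg hgs
  obtain ⟨k, hk, hk'⟩ := StoneCech.projective (X := D) (f := f ∘ r) (g := g)
    (hf.comp hr) hg hgs
  refine ⟨fun y : E => k y, hk.comp continuous_subtype_val, funext fun y => ?_⟩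
  have := congrFun hk' (y : E).1
  simp only [Function.comp_apply] at this ⊢
  rw [this]
  exact congrArg f (hid y)

/-- Every compact Hausdorff space has a projective cover. -/
theorem exists_projective_cover (X : CompHaus.{u}) :
    ∃ G : Cover X, CompactT2.Projective G.space := by
  exact @exists_projective_cover_aux X X ⊥ (@DiscreteTopology.mk _ ⊥ rfl) id
    Function.surjective_id

/-- Every compact Hausdorff space has a minimum quasi-F cover. -/
theorem exists_isLeast_quasiF (X : CompHaus.{u}) :
    ∃ Z₀ : Cover X, IsLeast {Z : Cover X | IsQuasiF Z.space} Z₀ := by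
  obtain ⟨G, hG⟩ := exists_projective_cover X
  have hT2 : T2Space X := X.is_hausdorff
  have hT1 : T1Space X := T2Space.t1Space
  have hcX : CompactSpace X := X.is_compact
  have hN : NormalSpace X := NormalSpace.of_compactSpace_r1Space
  let A : Set C(G.space, ℝ) := {a | ∀ Z : Cover X, IsQuasiF Z.space →
    ∀ φ : C(G.space, Z.space), G.map = Z.map.comp φ →
      ∃ b : C(Z.space, ℝ), ∀ x, b (φ x) = a x}
  let e₀ : G.space → (A → ℝ) := fun x a => a.1 x
  have he₀ : Continuous e₀ := continuous_pi fun a => a.1.continuous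
  have : CompactSpace (Set.range e₀) := isCompact_iff_compactSpace.mp (isCompact_range he₀)
  let Y : CompHaus.{u} := CompHaus.of (Set.range e₀)
  let e : C(G.space, Y) := ⟨Set.rangeFactorization e₀, he₀.subtype_mk _⟩
  have hes : Function.Surjective e := Set.rangeFactorization_surjective
  have heA : ∀ (x : G.space) (a : A), (e x).1 a = a.1 x := fun _ _ => rfl
  have heq : ∀ x y : G.space, (∀ a ∈ A, a x = a y) → e x = e y := fun x y h =>
    Subtype.ext (funext fun a => h a.1 a.2)
  have hfac : ∀ x y : G.space, e x = e y → G.map x = G.map y := by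
    intro x y hxy
    by_contra hne
    obtain ⟨b, hb0, hb1, -⟩ := exists_continuous_zero_one_of_isClosed
      (isClosed_singleton (x := G.map x)) (isClosed_singleton (x := G.map y))
      (by simpa using hne)
    have hbA : b.comp G.map ∈ A := fun Z _ φ hφ =>
      ⟨b.comp Z.map, fun z => by rw [hφ]; rfl⟩
    have h1 : b (G.map x) = b (G.map y) := by
      rw [← ContinuousMap.comp_apply, ← ContinuousMap.comp_apply, ← heA x ⟨_, hbA⟩, hxy]
      exact heA y ⟨_, hbA⟩
    rw [hb0 rfl, hb1 rfl] at h1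
    exact zero_ne_one h1
  obtain ⟨m, hm⟩ := exists_factor e hes G.map hfac
  have hme : (m : Y → X) ∘ e = G.map := funext hm
  have hmc : IsCoverMap m := (hme ▸ G.isCoverMap).left e.continuous hes m.continuous
  have hec : IsCoverMap e := (hme ▸ G.isCoverMap).right e.continuous hmc
  -- the maps to `Y` from the quasi-F covers
  have key : ∀ Z : Cover X, IsQuasiF Z.space → ∀ φ : C(G.space, Z.space),
      G.map = Z.map.comp φ → IsCoverMap φ ∧ ∃ ψ : C(Z.space, Y), IsCoverMap ψ ∧
        (∀ x, ψ (φ x) = e x) ∧ Z.map = m.comp ψ := by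
    intro Z hZ φ hφ
    have hφc : IsCoverMap φ := IsCoverMap.right (m := Z.map)
      (by have := G.isCoverMap; rw [hφ] at this; exact this) φ.continuous Z.isCoverMap
    obtain ⟨ψ, hψ⟩ := exists_factor φ hφc.surjective e fun x y hxy => heq x y fun a ha => by
      obtain ⟨b, hb⟩ := ha Z hZ φ hφ
      rw [← hb, ← hb, hxy]
    have hψe : (ψ : Z.space → Y) ∘ φ = e := funext hψ
    refine ⟨hφc, ψ, (hψe ▸ hec).left φ.continuous hφc.surjective ψ.continuous, hψ, ?_⟩
    ext z
    obtain ⟨x, rfl⟩ := hφc.surjective z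
    rw [ContinuousMap.comp_apply, hψ, hm, hφ, ContinuousMap.comp_apply]
  refine ⟨⟨Y, m, hmc⟩, ?_, ?_⟩
  · intro U hU hd h
    obtain ⟨H, hH⟩ := isQuasiF_of_projective G.space hG _ (hU.preimage e.continuous)
      (hec.dense_preimage hd) (pull e.continuous h)
    have hHA : H ∈ A := by
      intro Z hZ φ hφ
      obtain ⟨hφc, ψ, hψc, hψ, -⟩ := key Z hZ φ hφ
      obtain ⟨b, hb⟩ := hZ _ (hU.preimage ψ.continuous) (hψc.dense_preimage hd)
        (pull ψ.continuous h)
      refine ⟨b, fun x => ?_⟩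
      have hEq : Set.EqOn (b.comp φ) H (e ⁻¹' U) := by
        intro y hy
        have hy' : ψ (φ y) ∈ U := by rw [hψ]; exact hy
        have h1 := hb ⟨φ y, hy'⟩
        have h2 := hH ⟨y, hy⟩
        rw [ContinuousMap.comp_apply]
        refine h1.trans (Eq.trans ?_ h2.symm)
        exact congrArg h (Subtype.ext (hψ y))
      exact congrFun (Continuous.ext_on (hec.dense_preimage hd) (b.comp φ).continuous
        H.continuous hEq) x
    refine ⟨⟨fun y => y.1 ⟨H, hHA⟩, (continuous_apply _).comp continuous_subtype_val⟩, ?_⟩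
    rintro ⟨y, hy⟩
    obtain ⟨x, rfl⟩ := hes y
    exact hH ⟨x, hy⟩
  · intro Z hZ
    obtain ⟨φ, hφ, hφ'⟩ := hG G.map.continuous Z.map.continuous Z.isCoverMap.surjective
    obtain ⟨-, ψ, -, -, hψ⟩ := key Z hZ ⟨φ, hφ⟩ (by ext x; exact (congrFun hφ' x).symm)
    exact ⟨ψ, hψ⟩

/-- The minimum quasi-F cover `(qF X, qF_X)` of `X`. -/
noncomputable def qFCover (X : CompHaus.{u}) : Cover X :=
  (exists_isLeast_quasiF X).choose

theorem qFCover_isLeast (X : CompHaus.{u}) :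
    IsLeast {Z : Cover X | IsQuasiF Z.space} (qFCover X) :=
  (exists_isLeast_quasiF X).choose_spec

theorem isHomeomorph_qFCover_iff (X : CompHaus.{u}) :
    IsHomeomorph (qFCover X).map ↔ IsQuasiF X := by
  constructor
  · intro h
    exact (qFCover_isLeast X).1.of_homeomorph h.homeomorph
  · intro h
    obtain ⟨k, hk⟩ := (qFCover_isLeast X).2 (show (⟨X, ContinuousMap.id X,
      isCoverMap_of_isHomeomorph IsHomeomorph.id⟩ : Cover X) ∈ _ from h)
    have hk' : ∀ x, (qFCover X).map (k x) = x := fun x =>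
      (congrArg (fun g : C(X, X) => g x) hk).symm
    have hks : Set.range k = Set.univ := by
      refine (qFCover X).isCoverMap.eq_univ (isCompact_range k.continuous).isClosed ?_
      exact Set.eq_univ_of_forall fun x => ⟨k x, ⟨x, rfl⟩, hk' x⟩
    rw [isHomeomorph_iff_continuous_bijective]
    refine ⟨(qFCover X).map.continuous, fun a b hab => ?_, (qFCover X).isCoverMap.surjective⟩
    obtain ⟨x, rfl⟩ := Set.range_eq_univ.1 hks a
    obtain ⟨y, rfl⟩ := Set.range_eq_univ.1 hks b
    rw [hk', hk'] at hab
    rw [hab]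

/-- The quasi-F covering operator. -/
noncomputable def qF : CoveringOperator.{u} where
  cover := qFCover
  isLeast X := by
    simp only [isHomeomorph_qFCover_iff]
    exact qFCover_isLeast X

/-- The covering class of `qF` is the class of compact quasi-F spaces. -/
theorem mem_fix_qF (X : CompHaus.{u}) : X ∈ qF.Fix ↔ IsQuasiF X :=
  isHomeomorph_qFCover_iff X

/-- The identity cover, as an element of the class of spaces covered by `K`. -/
def CoveredBy.self (K : CompHaus.{u}) : CoveredBy K :=
  ⟨K, ContinuousMap.id K, isCoverMap_of_isHomeomorph IsHomeomorph.id⟩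

/-- The Stone–Čech compactification of the discrete space `ℕ`. -/
noncomputable abbrev betaNat : CompHaus.{0} := CompHaus.of (StoneCech ℕ)

/-- The one-point compactification of the discrete space `ℕ`. -/
noncomputable abbrev alphaNat : CompHaus.{0} := CompHaus.of (OnePoint ℕ)

/-- The canonical map `βℕ → αℕ`, the continuous extension of the inclusion `ℕ → αℕ`. -/
noncomputable def betaToAlpha : C(StoneCech ℕ, OnePoint ℕ) :=
  ⟨stoneCechExtend (OnePoint.continuous_coe (X := ℕ)),
    continuous_stoneCechExtend OnePoint.continuous_coe⟩

theorem isCoverMap_betaToAlpha : IsCoverMap betaToAlpha := by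
  have hex : ∀ n : ℕ, betaToAlpha (stoneCechUnit n) = (n : OnePoint ℕ) := fun n =>
    stoneCechExtend_stoneCechUnit (OnePoint.continuous_coe (X := ℕ)) n
  have hop : ∀ n : ℕ, IsOpen {(n : OnePoint ℕ)} := fun n => by
    have := OnePoint.isOpenEmbedding_coe.isOpenMap {n} (isOpen_discrete _)
    rwa [Set.image_singleton] at this
  have hfib : ∀ (n : ℕ) (p : StoneCech ℕ), betaToAlpha p = (n : OnePoint ℕ) →
      p = stoneCechUnit n := by
    intro n p hp
    by_contra hne
    have hO : IsOpen (betaToAlpha ⁻¹' {(n : OnePoint ℕ)} ∩ {stoneCechUnit n}ᶜ) :=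
      ((hop n).preimage betaToAlpha.continuous).inter isClosed_singleton.isOpen_compl
    obtain ⟨q, ⟨hq, hq'⟩, k, rfl⟩ := mem_closure_iff.1 (denseRange_stoneCechUnit p) _ hO ⟨hp, hne⟩
    have h1 : (k : OnePoint ℕ) = n := (hex k).symm.trans hq
    exact hq' (by rw [OnePoint.coe_injective h1]; rfl)
  refine isCoverMap_of_compact betaToAlpha.continuous ?_ fun F hF h => ?_
  · rw [← Set.range_eq_univ]
    refine Set.eq_univ_of_univ_subset ?_
    rw [← (OnePoint.denseRange_coe (X := ℕ)).closure_range]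
    refine closure_minimal ?_ (isCompact_range betaToAlpha.continuous).isClosed
    rintro _ ⟨n, rfl⟩
    exact ⟨_, hex n⟩
  · refine Set.eq_univ_of_univ_subset ?_
    rw [← (denseRange_stoneCechUnit (α := ℕ)).closure_range]
    refine closure_minimal ?_ hF
    rintro _ ⟨n, rfl⟩
    obtain ⟨p, hp, hpn⟩ : (n : OnePoint ℕ) ∈ betaToAlpha '' F := h ▸ Set.mem_univ _
    rwa [← hfib n p hpn]

/-- `αℕ` as a space covered by `βℕ`. -/
noncomputable def alphaNatCovered : CoveredBy betaNat :=
  ⟨alphaNat, betaToAlpha, isCoverMap_betaToAlpha⟩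

end CoveringOps

open CoveringOps

universe u

namespace CoveringOps

/-! For (i), irreducibility forbids a cover to glue an isolated point to any other point. The points
of `ℕ` are isolated in `βℕ`, so a cover `βℕ → X` can only glue points of the remainder, all of which
`αℕ` already collapses to `∞`. Hence `betaToAlpha` factors through every such cover
(`alphaNatCovered_le`). That `αℕ` itself belongs to the collection means that its minimum quasi-F
cover is `βℕ`. The set `ℕ` is a dense cozero-set of `αℕ`, so its preimage in any quasi-F cover is
`C*`-embedded. Functions on `ℕ` therefore extend over the cover, and enough of them exist to
separate the images of distinct points of `βℕ` (`injective_of_isQuasiF`). For (ii), the almost-P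
property implies quasi-F and passes down along covers. So every `X` with `qF X = K` is itself
quasi-F, its covering map is a homeomorphism, and only the class of `K` remains. -/

theorem betaToAlpha_stoneCechUnit (n : ℕ) :
    betaToAlpha (stoneCechUnit n) = (n : OnePoint ℕ) :=
  stoneCechExtend_stoneCechUnit (OnePoint.continuous_coe (X := ℕ)) n

theorem isOpen_singleton_coe (n : ℕ) : IsOpen {(n : OnePoint ℕ)} := by
  have := OnePoint.isOpenEmbedding_coe.isOpenMap {n} (isOpen_discrete _)
  rwa [Set.image_singleton] at this

/-! ### Isolated points and the lower bound `αℕ` -/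

theorem isQuasiF_stoneCech (D : Type u) [TopologicalSpace D] [DiscreteTopology D] :
    IsQuasiF (StoneCech D) :=
  isQuasiF_of_projective _ StoneCech.projective

/-- A cover does not identify an isolated point with another point. -/
theorem IsCoverMap.eq_of_isOpen_singleton {Y : Type v} {X : Type w} [TopologicalSpace Y]
    [TopologicalSpace X] {f : Y → X} (hf : IsCoverMap f) {a b : Y} (ha : IsOpen {a})
    (h : f a = f b) : b = a := by
  by_contra hne
  -- The complement of `a` is closed and still maps onto `X`, because `b` replaces `a` over their
  -- common image.
  have hun : ({a}ᶜ : Set Y) = Set.univ := by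
    refine hf.eq_univ ha.isClosed_compl (Set.eq_univ_of_forall fun x => ?_)
    obtain ⟨y, rfl⟩ := hf.surjective x
    by_cases hy : y = a
    · exact ⟨b, hne, by rw [hy, h]⟩
    · exact ⟨y, hy, rfl⟩
  exact (hun ▸ Set.mem_univ a : a ∈ ({a}ᶜ : Set Y)) rfl

/-- The fibre over the isolated point `n` is open. Removing the copy of `n` leaves an open set that
misses the dense copy of `ℕ`, so it is empty. -/
theorem eq_stoneCechUnit_of_betaToAlpha_eq {n : ℕ} {p : StoneCech ℕ}
    (hp : betaToAlpha p = (n : OnePoint ℕ)) : p = stoneCechUnit n := by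
  by_contra hne
  have hO : IsOpen (betaToAlpha ⁻¹' {(n : OnePoint ℕ)} ∩ {stoneCechUnit n}ᶜ) :=
    ((isOpen_singleton_coe n).preimage betaToAlpha.continuous).inter
      isClosed_singleton.isOpen_compl
  obtain ⟨q, ⟨hq, hq'⟩, k, rfl⟩ :=
    mem_closure_iff.1 (denseRange_stoneCechUnit p) _ hO ⟨hp, hne⟩
  have h1 : (k : OnePoint ℕ) = n := (betaToAlpha_stoneCechUnit k).symm.trans hq
  exact hq' (by rw [OnePoint.coe_injective h1]; rfl)

theorem isOpen_singleton_stoneCechUnit (n : ℕ) : IsOpen {(stoneCechUnit n : StoneCech ℕ)} := by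
  have h : {(stoneCechUnit n : StoneCech ℕ)} = betaToAlpha ⁻¹' {(n : OnePoint ℕ)} := by
    ext p
    refine ⟨?_, eq_stoneCechUnit_of_betaToAlpha_eq⟩
    rintro rfl
    exact betaToAlpha_stoneCechUnit n
  rw [h]
  exact (isOpen_singleton_coe n).preimage betaToAlpha.continuous

/-- `αℕ` is below every space covered by `βℕ`. -/
theorem alphaNatCovered_le (x : CoveredBy betaNat) : alphaNatCovered ≤ x := by
  have hiso : ∀ (n : ℕ) (a b : betaNat), betaToAlpha a = (n : OnePoint ℕ) →
      x.map a = x.map b → a = b := by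
    intro n a b ha hab
    obtain rfl := eq_stoneCechUnit_of_betaToAlpha_eq ha
    exact (x.isCoverMap.eq_of_isOpen_singleton (isOpen_singleton_stoneCechUnit n) hab).symm
  -- If either point lies over some `n`, then `hiso` makes the two points equal; otherwise both lie
  -- over `∞`.
  obtain ⟨m, hm⟩ := exists_factor x.map x.isCoverMap.surjective betaToAlpha fun a b hab => by
    rcases ha : betaToAlpha a with _ | n
    · rcases hb : betaToAlpha b with _ | n
      · rfl
      · rw [← ha, ← hb, hiso n b a hb hab.symm]
    · rw [← ha, hiso n a b ha hab]
  exact ⟨m, ContinuousMap.ext fun p => (hm p).symm⟩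

/-! ### The minimum quasi-F cover of `αℕ` -/

theorem isCozeroSet_range_coe : IsCozeroSet (Set.range ((↑) : ℕ → OnePoint ℕ)) := by
  have ht : Filter.Tendsto (fun n : ℕ => 1 / ((n : ℝ) + 1)) (Filter.coclosedCompact ℕ)
      (𝓝 0) := by
    rw [Filter.coclosedCompact_eq_cocompact, Filter.cocompact_eq_cofinite,
      Nat.cofinite_eq_atTop]
    exact tendsto_one_div_add_atTop_nhds_zero_nat
  -- Any nowhere vanishing null sequence, extended by `0` at `∞`, is a witness; the shift by one
  -- keeps the denominator nonzero at `n = 0`.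
  have hc : Continuous fun p : OnePoint ℕ => p.elim (0 : ℝ)
      (fun n : ℕ => 1 / ((n : ℝ) + 1)) := by
    rw [continuous_iff_continuousAt]
    intro p
    induction p using OnePoint.rec with
    | infty => exact OnePoint.continuousAt_infty'.2 ht
    | coe n => exact (OnePoint.continuousAt_coe).2 continuous_of_discreteTopology.continuousAt
  refine ⟨⟨_, hc⟩, ?_⟩
  ext p
  induction p using OnePoint.rec with
  | infty => simp
  | coe n => simpa using (Nat.cast_add_one_ne_zero n : (n : ℝ) + 1 ≠ 0)

/-- Every map over `αℕ` from `βℕ` to a quasi-F cover of `αℕ` is injective. -/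
theorem injective_of_isQuasiF (Z : Cover alphaNat) (hZ : IsQuasiF Z.space)
    (f : C(betaNat, Z.space)) (hf : betaToAlpha = Z.map.comp f) : Function.Injective f := by
  have hfp : ∀ p, Z.map (f p) = betaToAlpha p := fun p => by rw [hf]; rfl
  let U : Set Z.space := Z.map ⁻¹' Set.range ((↑) : ℕ → OnePoint ℕ)
  have hUd : Dense U := Z.isCoverMap.dense_preimage OnePoint.denseRange_coe
  -- On `U` the covering map takes values in `ℕ`; `r` is that map with codomain `ℕ`, continuous
  -- since `ℕ` is embedded in `αℕ`.
  choose r hr using fun z : U => z.2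
  have hrc : Continuous r := by
    refine OnePoint.isOpenEmbedding_coe.isInducing.continuous_iff.2 ?_
    have : ((↑) : ℕ → OnePoint ℕ) ∘ r = fun z : U => Z.map z.1 := funext hr
    rw [this]
    exact Z.map.continuous.comp continuous_subtype_val
  intro p q hpq
  by_contra hne
  obtain ⟨g, hg0, hg1, -⟩ := exists_continuous_zero_one_of_isClosed
    (isClosed_singleton (x := p)) (isClosed_singleton (x := q)) (by simpa using hne)
  -- Restrict the separating function `g` to `ℕ` and pull it back to `U` along `r`.
  let h : U →ᵇ ℝ := (BoundedContinuousFunction.mkOfCompact g).compContinuous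
    ⟨fun z => stoneCechUnit (r z), continuous_stoneCechUnit.comp hrc⟩
  obtain ⟨H, hH⟩ := hZ U (isCozeroSet_range_coe.preimage Z.map.continuous) hUd h
  -- Both sides are continuous and agree on the dense copy of `ℕ`, so `g` factors through `f` and
  -- cannot separate `p` from `q` when `f p = f q`.
  have hEq : (H ∘ f : StoneCech ℕ → ℝ) = g := by
    refine denseRange_stoneCechUnit.equalizer (H.comp f).continuous g.continuous
      (funext fun n => ?_)
    have hn : Z.map (f (stoneCechUnit n)) = (n : OnePoint ℕ) :=
      (hfp _).trans (betaToAlpha_stoneCechUnit n)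
    have hrn : r ⟨f (stoneCechUnit n), n, hn.symm⟩ = n :=
      OnePoint.coe_injective ((hr _).trans hn)
    refine (hH ⟨f (stoneCechUnit n), n, hn.symm⟩).trans ?_
    change g (stoneCechUnit (r _)) = g (stoneCechUnit n)
    rw [hrn]
  have h01 : g p = g q := by
    rw [← hEq, Function.comp_apply, Function.comp_apply, hpq]
  rw [hg0 rfl, hg1 rfl] at h01
  exact zero_ne_one h01

/-- Since `βℕ` is a quasi-F cover of `αℕ`, minimality gives a map `f` from it to `qF αℕ` over `αℕ`.
It is onto as the right factor of a cover and injective by `injective_of_isQuasiF`, hence a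
homeomorphism by compactness. -/
theorem alphaNatCovered_mem_S : alphaNatCovered.toClass ∈ S betaNat qF := by
  obtain ⟨f, hf⟩ := (qFCover_isLeast alphaNat).2
    (show (⟨betaNat, betaToAlpha, isCoverMap_betaToAlpha⟩ : Cover alphaNat) ∈ _ from
      isQuasiF_stoneCech ℕ)
  have hf' : betaToAlpha = (qFCover alphaNat).map.comp f := hf
  have hfc : IsCoverMap f := IsCoverMap.right (m := (qFCover alphaNat).map)
    (by have := isCoverMap_betaToAlpha; rw [hf'] at this; exact this) f.continuous
    (qFCover alphaNat).isCoverMap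
  have hfh : IsHomeomorph f := isHomeomorph_iff_continuous_bijective.2 ⟨f.continuous,
    injective_of_isQuasiF _ (qFCover_isLeast alphaNat).1 f hf', hfc.surjective⟩
  exact ⟨alphaNatCovered, ⟨hfh.homeomorph, fun p => (DFunLike.congr_fun hf' p).symm⟩, rfl⟩

/-! ### Almost-P spaces -/

theorem IsAlmostP.isQuasiF {X : Type u} [TopologicalSpace X] (hX : IsAlmostP X) :
    IsQuasiF X := by
  intro U hU hd h
  obtain rfl := hX U hU hd
  exact ⟨⟨fun x => h ⟨x, trivial⟩, h.continuous.comp (by fun_prop)⟩, fun _ => rfl⟩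

/-- A space covered by an almost-P space is almost-P. -/
theorem IsAlmostP.of_isCoverMap {Y : Type v} {X : Type w} [TopologicalSpace Y]
    [TopologicalSpace X] {f : Y → X} (hY : IsAlmostP Y) (hf : IsCoverMap f) : IsAlmostP X := by
  intro U hU hd
  -- The preimage of `U` is a dense cozero-set of `Y`, density coming from irreducibility, so it is
  -- all of `Y`.
  rw [← Set.image_preimage_eq U hf.surjective,
    hY _ (hU.preimage hf.continuous) (hf.dense_preimage hd), Set.image_univ,
    hf.surjective.range_eq]

theorem self_mem_S {K : CompHaus.{u}} (hK : K ∈ qF.Fix) : (CoveredBy.self K).toClass ∈ S K qF :=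
  ⟨CoveredBy.self K, ⟨(IsHomeomorph.homeomorph _ hK).symm,
    fun k => (IsHomeomorph.homeomorph _ hK).apply_symm_apply k⟩, rfl⟩

theorem CoveredBy.toClass_eq_self {K : CompHaus.{u}} (x : CoveredBy K)
    (hx : IsHomeomorph x.map) : x.toClass = (CoveredBy.self K).toClass := by
  refine le_antisymm ?_ ?_
  -- The identity of `K` lies above every space covered by `K`; the reverse comparison is where the
  -- inverse of `x.map` is needed.
  · exact (toAntisymmetrization_le_toAntisymmetrization_iff).2
      ⟨x.map, rfl⟩
  · exact (toAntisymmetrization_le_toAntisymmetrization_iff).2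
      ⟨⟨hx.homeomorph.symm, hx.homeomorph.symm.continuous⟩,
        ContinuousMap.ext fun k => (hx.homeomorph.symm_apply_apply k).symm⟩

theorem S_eq_singleton_of_isAlmostP {K : CompHaus.{u}} (hK : IsAlmostP K) :
    S K qF = {(CoveredBy.self K).toClass} := by
  refine Set.Subset.antisymm ?_
    (Set.singleton_subset_iff.2 (self_mem_S ((mem_fix_qF K).2 hK.isQuasiF)))
  rintro _ ⟨x, ⟨θ, hθ⟩, rfl⟩
  have hfix : IsHomeomorph (qF.cover x.space).map :=
    (mem_fix_qF x.space).2 (hK.of_isCoverMap x.isCoverMap).isQuasiF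
  -- The space below `K` is almost-P, hence fixed by `qF`, so `x.map` is a composite of two
  -- homeomorphisms.
  have hx : (x.map : K → x.space) = (qF.cover x.space).map ∘ θ := funext fun k => (hθ k).symm
  exact x.toClass_eq_self (hx ▸ hfix.comp θ.isHomeomorph)

end CoveringOps

theorem mainTheorem7 :
    (betaNat ∈ qF.{0}.Fix ∧ IsLeast (S betaNat qF) alphaNatCovered.toClass) ∧
    (∀ K : CompHaus.{u}, IsAlmostP K →
      K ∈ qF.{u}.Fix ∧
      S K qF = {(CoveredBy.self K).toClass} ∧
      IsLeast (S K qF) (CoveredBy.self K).toClass) := by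
  refine ⟨⟨(mem_fix_qF _).2 (isQuasiF_stoneCech ℕ), alphaNatCovered_mem_S, ?_⟩,
    fun K hK => ⟨(mem_fix_qF K).2 hK.isQuasiF, S_eq_singleton_of_isAlmostP hK, ?_⟩⟩
  · rintro _ ⟨x, -, rfl⟩
    exact toAntisymmetrization_le_toAntisymmetrization_iff.2 (alphaNatCovered_le x)
  · rw [S_eq_singleton_of_isAlmostP hK]
    exact isLeast_singleton
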